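/- Let $L_1, L_2 \subset \mathbb{R}^2$ be two fixed line segments of equal positive length that share the same midpoint and meet only at that point. For $N \ge 1$ let $\sigma_N > 0$, and let $(\mathbf{z}, \mathbf{X})$ be sampled from the Gaussian line mixture model $\mathrm{GLMM}_N(L_1, L_2, \sigma_N)$: the labels $z_1, \dots, z_N$ are independent and uniform on $\{1,2\}$, and given $\mathbf{z}$ the observations are $X_i = U_i + \sigma_N Y_i$, $i = 1, \dots, N$, where $U_i$ is uniform on $L_{z_i}$, $Y_i$ is a standard normal vector in $\mathbb{R}^2$, and all these variables are independent. An estimator is a measurable (possibly randomized) map from the data $\mathbf{X}$ to a label vector $\hat{\mathbf{z}} \in \{1,2\}^N$; it may depend on $N$, $L_1$, $L_2$ and $\sigma_N$, which are known. Let $$\mathrm{Ham}^*(\hat{\mathbf{z}}, \mathbf{z}) = \min_{\pi \in S_2} \sum_{i=1}^N \mathbf{1}\{\hat z_i \ne \pi(z_i)\}.$$ A sequence of estimators achieves exact recovery if $\lim_{N\to\infty} \mathbb{P}(\mathrm{Ham}^*(\hat{\mathbf{z}}, \mathbf{z}) = 0) = 1$, and almost exact recovery if $\lim_{N\to\infty}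 \mathbb{P}(\mathrm{Ham}^*(\hat{\mathbf{z}}, \mathbf{z})/N \le \varepsilon) = 1$ for every $\varepsilon > 0$. Then: 1. Exact recovery is achieved by some sequence of estimators if and only if $\lim_{N\to\infty} N\sigma_N = 0$. 2. Almost exact recovery is achieved by some sequence of estimators if and only if $\lim_{N\to\infty} \sigma_N = 0$. In each case, whenever the condition holds, the maximum likelihood estimator achieves the recovery. It sets $\hat z_i = 1$ if $f_1(X_i) > f_2(X_i)$ and $\hat z_i = 2$ otherwise, where $f_k$ is the Lebesgue density of $X_i$ given $z_i = k$. Whenever the condition fails, no sequence of estimators achieves the recovery. -/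

import Mathlib

open MeasureTheory ProbabilityTheory Filter Topology Asymptotics

namespace LineMixture

/-- The Euclidean plane. -/
abbrev Plane : Type := EuclideanSpace ℝ (Fin 2)

/-- The two community labels; `0` and `1` stand for the first and the second line segment. -/
abbrev Label : Type := Fin 2

/-- A (nondegenerate) line segment in the plane, given by its two distinct endpoints. -/
structure PlaneSegment where
  /-- one endpoint -/
  fst : Plane
  /-- the other endpoint -/
  snd : Plane
  /-- the endpoints are distinct -/
  ne : fst ≠ snd

namespace PlaneSegment

/-- The set of points of the segment. -/
def carrier (L : PlaneSegment) : Set Plane := segment ℝ L.fst L.snd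

/-- The length of the segment. -/
noncomputable def length (L : PlaneSegment) : ℝ := dist L.fst L.snd

/-- The midpoint of the segment. -/
noncomputable def mid (L : PlaneSegment) : Plane := midpoint ℝ L.fst L.snd

/-- The uniform distribution on the segment: the law of the point `(1 - t) • fst + t • snd`
with `t` uniform on `[0, 1]`. -/
noncomputable def uniform (L : PlaneSegment) : Measure Plane :=
  (volume.restrict (Set.Icc (0 : ℝ) 1)).map (fun t => AffineMap.lineMap L.fst L.snd t)

lemma measurable_param (L : PlaneSegment) :
    Measurable (fun t : ℝ => (AffineMap.lineMap L.fst L.snd t : Plane)) :=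
  AffineMap.lineMap_continuous.measurable

instance (L : PlaneSegment) : IsProbabilityMeasure L.uniform := by
  have : IsProbabilityMeasure (volume.restrict (Set.Icc (0 : ℝ) 1)) := ⟨by simp⟩
  exact Measure.isProbabilityMeasure_map L.measurable_param.aemeasurable

/-- The law of one observation `U + σ • Y` from the segment, where `U` is uniform on the segment
and `Y` is an independent standard normal vector of the plane. -/
noncomputable def observationLaw (L : PlaneSegment) (σ : ℝ) : Measure Plane :=
  (L.uniform.prod (stdGaussian Plane)).map (fun p => p.1 + σ • p.2)

instance (L : PlaneSegment) (σ : ℝ) : IsProbabilityMeasure (L.observationLaw σ) :=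
  Measure.isProbabilityMeasure_map (by fun_prop)

/-- The Lebesgue density of one observation from the segment with noise level `σ > 0`:
`σ⁻² ∫ φ((x₁ - u₁) / σ) φ((x₂ - u₂) / σ) G(du)`, where `G` is the uniform distribution on the
segment and `φ` is the standard normal density on the line. -/
noncomputable def density (L : PlaneSegment) (σ : ℝ) (x : Plane) : ℝ :=
  (1 / σ ^ 2) * ∫ u, gaussianPDFReal 0 1 ((x 0 - u 0) / σ) *
    gaussianPDFReal 0 1 ((x 1 - u 1) / σ) ∂L.uniform

lemma measurable_density (L : PlaneSegment) (σ : ℝ) : Measurable (L.density σ) := by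
  have h : Measurable (fun p : Plane × Plane => gaussianPDFReal 0 1 ((p.1 0 - p.2 0) / σ) *
      gaussianPDFReal 0 1 ((p.1 1 - p.2 1) / σ)) := by
    apply Measurable.mul <;> exact (measurable_gaussianPDFReal 0 1).comp (by fun_prop)
  exact (h.stronglyMeasurable.integral_prod_right (ν := L.uniform)).measurable.const_mul _

end PlaneSegment

/-- The Gaussian line mixture model given the label vector `z`: the law of `X = (X₁, …, X_N)`,
`Xᵢ = Uᵢ + σ • Yᵢ`, with `Uᵢ` uniform on the segment `L (z i)`, `Yᵢ` standard normal, and all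
these variables independent. -/
noncomputable def glmmGiven {N : ℕ} (L : Label → PlaneSegment) (σ : ℝ) (z : Fin N → Label) :
    Measure (Fin N → Plane) :=
  Measure.pi fun i => (L (z i)).observationLaw σ

instance {N : ℕ} (L : Label → PlaneSegment) (σ : ℝ) (z : Fin N → Label) :
    IsProbabilityMeasure (glmmGiven L σ z) := by
  unfold glmmGiven; infer_instance

/-- The conditional law of the data given the labels, as a Markov kernel. -/
noncomputable def glmmKernel (N : ℕ) (L : Label → PlaneSegment) (σ : ℝ) :
    Kernel (Fin N → Label) (Fin N → Plane) :=
  Kernel.ofFunOfCountable (glmmGiven L σ)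

instance (N : ℕ) (L : Label → PlaneSegment) (σ : ℝ) : IsMarkovKernel (glmmKernel N L σ) :=
  ⟨fun z => inferInstanceAs (IsProbabilityMeasure (glmmGiven L σ z))⟩

/-- The law of a vector of `N` independent labels, each uniform on the two communities. -/
noncomputable def labelLaw (N : ℕ) : Measure (Fin N → Label) :=
  Measure.pi fun _ => uniformOn (Set.univ : Set Label)

instance : IsProbabilityMeasure (uniformOn (Set.univ : Set Label)) :=
  isProbabilityMeasure_uniformOn Set.finite_univ Set.univ_nonempty

instance (N : ℕ) : IsProbabilityMeasure (labelLaw N) := by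
  unfold labelLaw; infer_instance

/-- The Gaussian line mixture model: the joint law of the labels and the data `(z, X)`. -/
noncomputable def glmm (N : ℕ) (L : Label → PlaneSegment) (σ : ℝ) :
    Measure ((Fin N → Label) × (Fin N → Plane)) :=
  labelLaw N ⊗ₘ glmmKernel N L σ

instance (N : ℕ) (L : Label → PlaneSegment) (σ : ℝ) : IsProbabilityMeasure (glmm N L σ) := by
  unfold glmm; infer_instance

/-- A (possibly randomized) estimator of the labels of `N` points: a Markov kernel from data sets
to label vectors. -/
structure Estimator (N : ℕ) where
  /-- the law of the output given the data -/
  kernel : Kernel (Fin N → Plane) (Fin N → Label)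
  /-- this law is a probability measure -/
  markov : IsMarkovKernel kernel

instance {N : ℕ} (e : Estimator N) : IsMarkovKernel e.kernel := e.markov

/-- A measurable map from data sets to label vectors, as an estimator. -/
noncomputable def Estimator.ofMap {N : ℕ} (f : (Fin N → Plane) → (Fin N → Label))
    (hf : Measurable f) : Estimator N :=
  ⟨Kernel.deterministic f hf, inferInstance⟩

/-- The joint law of `((z, X), ẑ)`, where `(z, X)` comes from the Gaussian line mixture model and
`ẑ` is the output of the estimator on the data `X`. -/
noncomputable def jointLaw {N : ℕ} (L : Label → PlaneSegment) (σ : ℝ) (e : Estimator N) :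
    Measure (((Fin N → Label) × (Fin N → Plane)) × (Fin N → Label)) :=
  glmm N L σ ⊗ₘ Kernel.prodMkLeft (Fin N → Label) e.kernel

instance {N : ℕ} (L : Label → PlaneSegment) (σ : ℝ) (e : Estimator N) :
    IsProbabilityMeasure (jointLaw L σ e) := by
  unfold jointLaw; infer_instance

/-- The permutation-invariant Hamming distance: the number of misclassified points, minimized over
the permutations of the two labels. -/
def hamStar {N : ℕ} (zhat z : Fin N → Label) : ℕ :=
  Finset.univ.inf' Finset.univ_nonempty
    (fun π : Equiv.Perm Label => hammingDist zhat (fun i => π (z i)))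

/-- Exact recovery: `P(Ham*(ẑ, z) = 0) → 1`. -/
def ExactRecovery (L : Label → PlaneSegment) (σ : ℕ → ℝ) (e : ∀ N, Estimator N) : Prop :=
  Tendsto (fun N => jointLaw L (σ N) (e N) {ω | hamStar ω.2 ω.1.1 = 0}) atTop (𝓝 1)

/-- Almost exact recovery: `P(Ham*(ẑ, z) / N ≤ ε) → 1` for every `ε > 0`. -/
def AlmostExactRecovery (L : Label → PlaneSegment) (σ : ℕ → ℝ) (e : ∀ N, Estimator N) : Prop :=
  ∀ ε : ℝ, 0 < ε →
    Tendsto (fun N => jointLaw L (σ N) (e N) {ω | (hamStar ω.2 ω.1.1 : ℝ) / N ≤ ε}) atTop (𝓝 1)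

open Classical in
/-- The maximum likelihood labels: each point gets the label whose density is larger at it
(the second label in case of a tie). -/
noncomputable def mleLabels (N : ℕ) (L : Label → PlaneSegment) (σ : ℝ) (x : Fin N → Plane) :
    Fin N → Label :=
  fun i => if (L 0).density σ (x i) > (L 1).density σ (x i) then 0 else 1

lemma measurable_mleLabels (N : ℕ) (L : Label → PlaneSegment) (σ : ℝ) :
    Measurable (mleLabels N L σ) := by
  refine measurable_pi_lambda _ fun i => Measurable.ite ?_ measurable_const measurable_const
  exact measurableSet_lt (((L 1).measurable_density σ).comp (measurable_pi_apply i))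
    (((L 0).measurable_density σ).comp (measurable_pi_apply i))

/-- The maximum likelihood estimator, for known segments and noise level. -/
noncomputable def mle (N : ℕ) (L : Label → PlaneSegment) (σ : ℝ) : Estimator N :=
  Estimator.ofMap (mleLabels N L σ) (measurable_mleLabels N L σ)

end LineMixture

namespace LineMixture

open scoped ENNReal NNReal

/-! Points drawn near the common midpoint are the only hard ones. They form a fraction of order `σ`
of the data, so the number of errors is of order `N * σ`, and both thresholds follow from bounds on
a single observation.

Upper bound: the total error of the likelihood comparison is at most that of the test "which of the
two lines is closer?". That test fails only if the uniform parameter lies within a multiple of `σ *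
‖y‖` of `1 / 2`, where `y` is the noise; integrating over `y` gives `C * σ`
(`exists_likelihood_error_le`). Linearity of expectation and Markov's inequality finish both
recovery claims.

Lower bound: both observation laws dominate one Gaussian at the midpoint of mass of order `min σ 1`,
hence lie below a measure `M` of mass at most `2 * (1 - c * min σ 1)` (`exists_observationLaw_le`).
Replacing laws by `M` makes the data independent of the labels concerned. For exact recovery this is
done at all indices but one, which fixes the permutation, so the success probability is at most `(M
Set.univ / 2) ^ (N - 1)` (`exact_success_le`). For almost exact recovery it is done at one index of
a pair: correctness at two indices disagrees with probability at least `c * min σ 1`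
(`pair_agreement_le`), whichever permutation is used. Few errors would leave few such pairs
(`hamStar_count`). -/

lemma _root_.MeasureTheory.Measure.pi_mono_measure {ι : Type*} [Fintype ι] {α : ι → Type*}
    [∀ i, MeasurableSpace (α i)] {μ ν : ∀ i, Measure (α i)} (h : ∀ i, μ i ≤ ν i) :
    Measure.pi μ ≤ Measure.pi ν := by
  refine Measure.le_iff.2 fun s hs => ?_
  rw [Measure.pi, Measure.pi, toMeasure_apply _ _ hs, toMeasure_apply _ _ hs]
  -- The product outer measure is the largest one bounded on boxes by the product of the factors.
  have : OuterMeasure.pi (fun i => (μ i).toOuterMeasure) ≤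
      OuterMeasure.pi (fun i => (ν i).toOuterMeasure) :=
    OuterMeasure.le_pi.2 fun t _ => (OuterMeasure.pi_pi_le _ t).trans
      (Finset.prod_le_prod' fun i _ => h i (t i))
  exact this s

/-! ### Exact recovery: guessing all labels when one is revealed -/

lemma labelLaw_singleton {N : ℕ} (z : Fin N → Label) : labelLaw N {z} = (2 ^ N)⁻¹ := by
  have h (a : Label) : uniformOn (Set.univ : Set Label) {a} = 2⁻¹ := by
    simp [uniformOn_univ]
  rw [labelLaw, Measure.pi_singleton]
  simp [h, ENNReal.inv_pow]

lemma measurableSet_outcome {N : ℕ} (Q : (Fin N → Label) → (Fin N → Label) → Prop) :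
    MeasurableSet {ω : ((Fin N → Label) × (Fin N → Plane)) × (Fin N → Label) |
      Q ω.2 ω.1.1} := by
  have : Measurable (fun ω : ((Fin N → Label) × (Fin N → Plane)) × (Fin N → Label) =>
    (ω.2, ω.1.1)) := by fun_prop
  exact this (Set.to_countable {p : (Fin N → Label) × (Fin N → Label) | Q p.1 p.2}).measurableSet

lemma jointLaw_apply {N : ℕ} (L : Label → PlaneSegment) (σ : ℝ) (e : Estimator N)
    (Q : (Fin N → Label) → (Fin N → Label) → Prop) :
    jointLaw L σ e {ω | Q ω.2 ω.1.1} =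
      (2 ^ N)⁻¹ * ∑ z, ∫⁻ x, e.kernel x {y | Q y z} ∂glmmGiven L σ z := by
  have hS := measurableSet_outcome Q
  rw [jointLaw, Measure.compProd_apply hS, glmm, Measure.lintegral_compProd
    (Kernel.measurable_kernel_prodMk_left hS), lintegral_fintype, Finset.mul_sum]
  refine Finset.sum_congr rfl fun z _ => ?_
  rw [labelLaw_singleton, mul_comm]
  rfl

lemma hamStar_eq_zero_iff {N : ℕ} (y z : Fin N → Label) :
    hamStar y z = 0 ↔ ∃ π : Equiv.Perm Label, y = fun i => π (z i) := by
  constructor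
  · intro h
    obtain ⟨π, -, hπ⟩ := Finset.exists_mem_eq_inf' (Finset.univ_nonempty)
      (fun π : Equiv.Perm Label => hammingDist y (fun i => π (z i)))
    exact ⟨π, hammingDist_eq_zero.1 (hπ.symm.trans h)⟩
  · rintro ⟨π, hπ⟩
    have : hamStar y z ≤ hammingDist y (fun i => π (z i)) := Finset.inf'_le _ (Finset.mem_univ π)
    rw [hπ, hammingDist_self, ← hπ] at this
    omega

/-- Fixing the label at index `0` removes the permutation ambiguity: an output `y` determines the
permutation from `y 0`, hence all of `z`. The success events are therefore disjoint. -/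
lemma sum_kernel_exact_le_one {n : ℕ} (e : Estimator (n + 1)) (a : Label)
    (x : Fin (n + 1) → Plane) :
    ∑ z ∈ Finset.univ.filter (fun z : Fin (n + 1) → Label => z 0 = a),
      e.kernel x {y | hamStar y z = 0} ≤ 1 := by
  rw [← measure_biUnion_finset _ (fun z _ => (Set.to_countable _).measurableSet)]
  · exact prob_le_one
  · intro z hz w hw hzw
    refine Set.disjoint_left.2 fun y hy hy' => hzw ?_
    obtain ⟨π, hπ⟩ := (hamStar_eq_zero_iff y z).1 hy
    obtain ⟨ρ, hρ⟩ := (hamStar_eq_zero_iff y w).1 hy'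
    have hz : z 0 = a := by simpa using hz
    have hw : w 0 = a := by simpa using hw
    have h0 : π a = ρ a := by
      have := congrFun (hπ.symm.trans hρ) 0
      simpa [hz, hw] using this
    have hπρ : π = ρ := by
      clear * - h0
      revert π ρ a
      decide
    funext i
    have := congrFun (hπ.symm.trans hρ) i
    rw [hπρ] at this
    exact ρ.injective this

/-- If `M` bounds both observation laws, the probability of exact recovery is bounded by the chance of
guessing all labels when one of them is revealed. -/
lemma exact_success_le {n : ℕ} (L : Label → PlaneSegment) (σ : ℝ) (e : Estimator (n + 1))
    (M : Measure Plane) [IsFiniteMeasure M] (hM : ∀ k, (L k).observationLaw σ ≤ M) :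
    jointLaw L σ e {ω | hamStar ω.2 ω.1.1 = 0} ≤ (M Set.univ / 2) ^ n := by
  rw [jointLaw_apply L σ e (fun y z => hamStar y z = 0)]
  have key (a : Label) : ∑ z ∈ Finset.univ.filter (fun z : Fin (n + 1) → Label => z 0 = a),
      ∫⁻ x, e.kernel x {y | hamStar y z = 0} ∂glmmGiven L σ z ≤ M Set.univ ^ n := by
    -- This dominating law no longer depends on `z` within the class `z 0 = a`, so the sum over `z`
    -- moves inside the integral.
    let Q : Fin (n + 1) → Measure Plane := fun i => if i = 0 then (L a).observationLaw σ else M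
    have hQ (i) : IsFiniteMeasure (Q i) := by
      simp only [Q]; split_ifs <;> infer_instance
    calc _ ≤ ∑ z ∈ Finset.univ.filter (fun z : Fin (n + 1) → Label => z 0 = a),
          ∫⁻ x, e.kernel x {y | hamStar y z = 0} ∂Measure.pi Q := by
          refine Finset.sum_le_sum fun z hz => lintegral_mono' ?_ le_rfl
          refine Measure.pi_mono_measure fun i => ?_
          have hz : z 0 = a := by simpa using hz
          by_cases hi : i = 0
          · simp [Q, hi, hz]
          · simpa [Q, hi] using hM (z i)
      _ = ∫⁻ x, ∑ z ∈ Finset.univ.filter (fun z : Fin (n + 1) → Label => z 0 = a),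
          e.kernel x {y | hamStar y z = 0} ∂Measure.pi Q := by
          rw [lintegral_finsetSum]
          exact fun z _ => e.kernel.measurable_coe (Set.to_countable _).measurableSet
      _ ≤ ∫⁻ x, 1 ∂Measure.pi Q := lintegral_mono fun x => sum_kernel_exact_le_one e a x
      _ = M Set.univ ^ n := by
          simp [Measure.pi_univ, Fin.prod_univ_succ, Q]
  rw [← Finset.sum_fiberwise (s := Finset.univ) (g := fun z : Fin (n + 1) → Label => z 0)]
  -- The two classes `a` absorb one of the `n + 1` factors `1 / 2`.
  calc _ ≤ (2 ^ (n + 1))⁻¹ * ∑ a : Label, M Set.univ ^ n := by gcongr with a; exact key a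
    _ = (M Set.univ / 2) ^ n := by
      simp only [Finset.sum_const, Finset.card_univ, Fintype.card_fin, nsmul_eq_mul]
      rw [div_eq_mul_inv, mul_pow, ← ENNReal.inv_pow, pow_succ, ENNReal.mul_inv (by simp) (by simp)]
      rw [mul_assoc, ← mul_assoc (2⁻¹ : ℝ≥0∞)]
      simp [ENNReal.mul_inv_cancel, mul_comm]

/-! ### Almost exact recovery: correctness compared on pairs of indices -/

/-- Flip the label at one index. -/
def flipAt {N : ℕ} (i : Fin N) (z : Fin N → Label) : Fin N → Label :=
  Function.update z i (1 - z i)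

lemma flipAt_involutive {N : ℕ} (i : Fin N) : Function.Involutive (flipAt i) := by
  intro z; simp [flipAt]

/-- Whether two labels agree is misjudged with probability at least the overlap of the laws. -/
lemma pair_agreement_le {N : ℕ} (L : Label → PlaneSegment) (σ : ℝ) (e : Estimator N)
    (M : Measure Plane) [IsFiniteMeasure M] (hM : ∀ k, (L k).observationLaw σ ≤ M)
    {i j : Fin N} (hij : i ≠ j) :
    jointLaw L σ e {ω | (ω.2 i = ω.1.1 i ↔ ω.2 j = ω.1.1 j)} ≤ M Set.univ / 2 := by
  rw [jointLaw_apply L σ e (fun y z => (y i = z i ↔ y j = z j))]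
  set G : (Fin N → Label) → ℝ≥0∞ := fun z =>
    ∫⁻ x, e.kernel x {y | (y i = z i ↔ y j = z j)} ∂glmmGiven L σ z with hG
  have hflip (z : Fin N → Label) : G z + G (flipAt i z) ≤ M Set.univ := by
    -- The label vectors `z` and `flipAt i z` differ only at `i`, so one measure with `M` there
    -- dominates both conditional laws, and its mass is that of `M`.
    let Q : Fin N → Measure Plane := fun k => if k = i then M else (L (z k)).observationLaw σ
    have hQ (i) : IsFiniteMeasure (Q i) := by
      simp only [Q]; split_ifs <;> infer_instance
    have hG1 : G z ≤ ∫⁻ x, e.kernel x {y | (y i = z i ↔ y j = z j)} ∂Measure.pi Q := by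
      refine lintegral_mono' (Measure.pi_mono_measure fun k => ?_) le_rfl
      by_cases hk : k = i
      · simpa [Q, hk] using hM _
      · simp [Q, hk]
    have hG2 : G (flipAt i z) ≤
        ∫⁻ x, e.kernel x {y | (y i = z i ↔ y j = z j)}ᶜ ∂Measure.pi Q := by
      refine lintegral_mono' (Measure.pi_mono_measure fun k => ?_) fun x => measure_mono ?_
      · by_cases hk : k = i
        · simpa [Q, hk] using hM _
        · simp [Q, hk, flipAt]
      -- With two labels, flipping `z i` reverses whether `y i` is correct and leaves `j` alone, so
      -- agreement becomes disagreement.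
      · intro y hy
        simp only [Set.mem_ofPred_eq, Set.mem_compl_iff, flipAt, Function.update_self,
          Function.update_of_ne hij.symm] at hy ⊢
        rw [← hy]
        generalize y i = p
        generalize z i = q
        revert p q
        decide
    calc _ ≤ _ := add_le_add hG1 hG2
      _ = ∫⁻ x, 1 ∂Measure.pi Q := by
        rw [← lintegral_add_left
          (e.kernel.measurable_coe (Set.to_countable _).measurableSet)]
        refine lintegral_congr fun x => ?_
        rw [measure_add_measure_compl (Set.to_countable _).measurableSet, measure_univ]
      _ = M Set.univ := by
        rw [lintegral_one, Measure.pi_univ, Finset.prod_eq_single i]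
        · simp [Q]
        · intro k _ hk
          simp [Q, hk]
        · simp
  have hsum : ∑ z, G (flipAt i z) = ∑ z, G z :=
    Fintype.sum_equiv (flipAt_involutive i).toPerm _ _ fun z => rfl
  have h2 : 2 * ∑ z, G z ≤ 2 ^ N * M Set.univ := by
    calc 2 * ∑ z, G z = ∑ z, (G z + G (flipAt i z)) := by
          rw [Finset.sum_add_distrib, hsum, two_mul]
      _ ≤ ∑ z : Fin N → Label, M Set.univ := Finset.sum_le_sum fun z _ => hflip z
      _ = _ := by simp
  rw [ENNReal.le_div_iff_mul_le (by simp) (by simp), mul_assoc, mul_comm _ (2 : ℝ≥0∞),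
    mul_comm, ← div_eq_mul_inv]
  exact ENNReal.div_le_of_le_mul' h2

/-- Swapping the two labels changes correctness at both indices, so disagreement within a pair
survives any permutation. Under the optimal one, a disagreeing pair contains a misclassified index,
which leaves at most `2 * N` ordered pairs per error. -/
lemma hamStar_count {N : ℕ} (y z : Fin N → Label) :
    ((Finset.univ ×ˢ Finset.univ).filter
      (fun p : Fin N × Fin N => ¬ (y p.1 = z p.1 ↔ y p.2 = z p.2))).card ≤
      2 * N * hamStar y z := by
  obtain ⟨π, -, hπ⟩ := Finset.exists_mem_eq_inf' (Finset.univ_nonempty)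
      (fun π : Equiv.Perm Label => hammingDist y (fun i => π (z i)))
  have hπ' : hamStar y z = hammingDist y (fun i => π (z i)) := hπ
  set E := Finset.univ.filter (fun i => y i ≠ π (z i)) with hE
  have hcard : E.card = hamStar y z := by rw [hπ']; rfl
  have hsub : (Finset.univ ×ˢ Finset.univ).filter
      (fun p : Fin N × Fin N => ¬ (y p.1 = z p.1 ↔ y p.2 = z p.2)) ⊆
      (E ×ˢ Finset.univ) ∪ (Finset.univ ×ˢ E) := by
    intro p hp
    simp only [Finset.mem_filter, Finset.mem_union, Finset.mem_product, Finset.mem_univ,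
      true_and, and_true, hE] at hp ⊢
    by_contra! hcon
    rw [hcon.1, hcon.2] at hp
    generalize z p.1 = a at hp
    generalize z p.2 = b at hp
    clear hE hcard hcon hπ hπ' E
    revert π a b
    decide
  calc _ ≤ _ := Finset.card_le_card hsub
    _ ≤ _ := Finset.card_union_le _ _
    _ = 2 * N * hamStar y z := by
      rw [Finset.card_product, Finset.card_product, hcard, Finset.card_univ, Fintype.card_fin]
      ring

/-! ### Densities of the observations and optimality of the likelihood test -/

/-- The density of `u + σ • Y` for a standard normal vector `Y` of the plane. -/
noncomputable def planeGaussian (σ : ℝ) (u x : Plane) : ℝ :=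
  1 / σ ^ 2 * (gaussianPDFReal 0 1 ((x 0 - u 0) / σ) * gaussianPDFReal 0 1 ((x 1 - u 1) / σ))

lemma planeGaussian_nonneg (σ : ℝ) (u x : Plane) : 0 ≤ planeGaussian σ u x := by
  unfold planeGaussian
  have := gaussianPDFReal_nonneg 0 1 ((x 0 - u 0) / σ)
  have := gaussianPDFReal_nonneg 0 1 ((x 1 - u 1) / σ)
  positivity

lemma measurable_planeGaussian (σ : ℝ) :
    Measurable (fun p : Plane × Plane => planeGaussian σ p.1 p.2) := by
  unfold planeGaussian
  refine Measurable.const_mul (Measurable.mul ?_ ?_) _ <;>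
    exact (measurable_gaussianPDFReal 0 1).comp (by fun_prop)

lemma measurable_planeGaussian_left (σ : ℝ) (x : Plane) :
    Measurable (fun u => planeGaussian σ u x) :=
  (measurable_planeGaussian σ).comp (f := fun u : Plane => (u, x)) (by fun_prop)

lemma measurable_planeGaussian_right (σ : ℝ) (u : Plane) : Measurable (planeGaussian σ u) :=
  (measurable_planeGaussian σ).comp (f := fun x : Plane => (u, x)) (by fun_prop)

lemma planeGaussian_eq {σ : ℝ} (hσ : 0 < σ) (u x : Plane) :
    planeGaussian σ u x = 1 / (2 * Real.pi * σ ^ 2) *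
      Real.exp (-((x 0 - u 0) ^ 2 + (x 1 - u 1) ^ 2) / (2 * σ ^ 2)) := by
  have h2 : √(2 * Real.pi) * √(2 * Real.pi) = 2 * Real.pi := Real.mul_self_sqrt (by positivity)
  have hne : √(2 * Real.pi) ≠ 0 := by positivity
  have : -((x 0 - u 0) ^ 2 + (x 1 - u 1) ^ 2) / (2 * σ ^ 2) =
      -((x 0 - u 0) / σ) ^ 2 / 2 + -((x 1 - u 1) / σ) ^ 2 / 2 := by
    field_simp; ring
  rw [this, Real.exp_add, ← h2]
  simp only [planeGaussian, gaussianPDFReal, sub_zero, NNReal.coe_one, mul_one]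
  field_simp

lemma planeGaussian_le {σ : ℝ} (hσ : 0 < σ) (u x : Plane) :
    planeGaussian σ u x ≤ 1 / (2 * Real.pi * σ ^ 2) := by
  rw [planeGaussian_eq hσ]
  refine mul_le_of_le_one_right (by positivity) (Real.exp_le_one_iff.2 ?_)
  rw [neg_div]
  exact neg_nonpos.2 (by positivity)

lemma planeGaussian_eq_mul {σ : ℝ} (hσ : 0 < σ) (u x : Plane) :
    planeGaussian σ u x = gaussianPDFReal (u 0) (σ.toNNReal ^ 2) (x 0) *
      gaussianPDFReal (u 1) (σ.toNNReal ^ 2) (x 1) := by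
  have h2 : √(2 * Real.pi * σ ^ 2) * √(2 * Real.pi * σ ^ 2) = 2 * Real.pi * σ ^ 2 :=
    Real.mul_self_sqrt (by positivity)
  have hne : √(2 * Real.pi * σ ^ 2) ≠ 0 := by positivity
  rw [planeGaussian_eq hσ, neg_add, add_div, Real.exp_add, ← h2]
  simp only [gaussianPDFReal, NNReal.coe_pow, Real.coe_toNNReal _ hσ.le]
  field_simp

lemma gaussianReal_map_affine (u σ : ℝ) (hσ : 0 < σ) :
    (gaussianReal 0 1).map (fun y => u + σ * y) = gaussianReal u (σ.toNNReal ^ 2) := by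
  have : (fun y => u + σ * y) = (fun y => u + y) ∘ (fun y => σ * y) := rfl
  rw [this, ← Measure.map_map (by fun_prop) (by fun_prop), gaussianReal_map_const_mul,
    gaussianReal_map_const_add]
  congr 1
  · simp
  · ext
    simp [hσ.le]

lemma map_affine_stdGaussian {σ : ℝ} (hσ : 0 < σ) (u : Plane) :
    (stdGaussian Plane).map (fun y => u + σ • y) =
      volume.withDensity (fun x => ENNReal.ofReal (planeGaussian σ u x)) := by
  set v : ℝ≥0 := σ.toNNReal ^ 2 with hv
  have hv0 : v ≠ 0 := by
    have : 0 < σ.toNNReal := by simpa using hσ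
    positivity
  have hprod : (gaussianReal (u 0) v).prod (gaussianReal (u 1) v) =
      (volume : Measure (ℝ × ℝ)).withDensity
        (fun p => ENNReal.ofReal (gaussianPDFReal (u 0) v p.1 * gaussianPDFReal (u 1) v p.2)) := by
    rw [gaussianReal_of_var_ne_zero _ hv0, gaussianReal_of_var_ne_zero _ hv0,
      prod_withDensity (measurable_gaussianPDF _ _) (measurable_gaussianPDF _ _)]
    simp only [gaussianPDF, ENNReal.ofReal_mul (gaussianPDFReal_nonneg _ _ _)]
    rfl
  let T : ℝ × ℝ ≃ᵐ Plane := MeasurableEquiv.finTwoArrow.symm.trans (MeasurableEquiv.toLp 2 _)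
  have hT : MeasurePreserving T volume volume :=
    ((volume_preserving_finTwoArrow ℝ).symm _).trans (PiLp.volume_preserving_toLp (Fin 2))
  have h1 : (stdGaussian Plane).map (fun y => u + σ • y) =
      ((gaussianReal (u 0) v).prod (gaussianReal (u 1) v)).map T := by
    have hpi : (Measure.pi fun _ : Fin 2 => gaussianReal 0 1).map
        (fun y i => u i + σ * y i) = Measure.pi fun i : Fin 2 => gaussianReal (u i) v := by
      rw [Measure.pi_map_pi (f := fun i y => u i + σ * y) (by fun_prop)]
      simp_rw [gaussianReal_map_affine _ _ hσ, hv]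
    have hvec : Measure.pi (fun i : Fin 2 => gaussianReal (u i) v) =
        ((gaussianReal (u 0) v).prod (gaussianReal (u 1) v)).map
          (MeasurableEquiv.finTwoArrow (α := ℝ)).symm := by
      have := ((measurePreserving_finTwoArrow_vec (gaussianReal (u 0) v)
        (gaussianReal (u 1) v)).symm _).map_eq
      rw [this]
      congr 1
      funext i
      fin_cases i <;> rfl
    rw [← map_pi_eq_stdGaussian, Measure.map_map (by fun_prop) (by fun_prop)]
    have hT' : ((gaussianReal (u 0) v).prod (gaussianReal (u 1) v)).map T =
        (((gaussianReal (u 0) v).prod (gaussianReal (u 1) v)).map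
          (MeasurableEquiv.finTwoArrow (α := ℝ)).symm).map (WithLp.toLp 2) :=
      (Measure.map_map (g := WithLp.toLp 2)
        (f := (MeasurableEquiv.finTwoArrow (α := ℝ)).symm) (by fun_prop) (by fun_prop)).symm
    rw [hT', ← hvec, ← hpi, Measure.map_map (by fun_prop) (by fun_prop)]
    rfl
  rw [h1, hprod]
  ext s hs
  rw [Measure.map_apply T.measurable hs, withDensity_apply _ (T.measurable hs),
    withDensity_apply _ hs, ← hT.setLIntegral_comp_preimage hs]
  · refine lintegral_congr fun p => ?_
    rw [planeGaussian_eq_mul hσ]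
    rfl
  · exact (measurable_planeGaussian_right σ u).ennreal_ofReal

namespace PlaneSegment

lemma observationLaw_apply (L : PlaneSegment) (σ : ℝ) {s : Set Plane} (hs : MeasurableSet s) :
    L.observationLaw σ s =
      ∫⁻ u, (stdGaussian Plane).map (fun y => u + σ • y) s ∂L.uniform := by
  have hm : Measurable (fun p : Plane × Plane => p.1 + σ • p.2) := by fun_prop
  rw [observationLaw, Measure.map_apply hm hs, Measure.prod_apply (hm hs)]
  refine lintegral_congr fun u => ?_
  rw [Measure.map_apply (by fun_prop) hs]
  rfl

lemma ofReal_density_eq (L : PlaneSegment) {σ : ℝ} (hσ : 0 < σ) (x : Plane) :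
    ENNReal.ofReal (L.density σ x) =
      ∫⁻ u, ENNReal.ofReal (planeGaussian σ u x) ∂L.uniform := by
  have hint : Integrable (fun u => planeGaussian σ u x) L.uniform :=
    Integrable.of_bound (measurable_planeGaussian_left σ x).aestronglyMeasurable (1 / (2 * Real.pi * σ ^ 2))
      (Eventually.of_forall fun u =>
        (Real.norm_of_nonneg (planeGaussian_nonneg σ u x)).trans_le (planeGaussian_le hσ u x))
  have heq : L.density σ x = ∫ u, planeGaussian σ u x ∂L.uniform :=
    (integral_const_mul _ _).symm
  rw [heq]
  exact ofReal_integral_eq_lintegral_ofReal hint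
    (Eventually.of_forall fun u => planeGaussian_nonneg σ u x)

lemma observationLaw_eq_withDensity (L : PlaneSegment) {σ : ℝ} (hσ : 0 < σ) :
    L.observationLaw σ = volume.withDensity (fun x => ENNReal.ofReal (L.density σ x)) := by
  ext s hs
  rw [L.observationLaw_apply σ hs, withDensity_apply _ hs]
  have hG (u : Plane) : (stdGaussian Plane).map (fun y => u + σ • y) s =
      ∫⁻ x in s, ENNReal.ofReal (planeGaussian σ u x) := by
    rw [map_affine_stdGaussian hσ, withDensity_apply _ hs]
  rw [lintegral_congr hG, lintegral_congr (L.ofReal_density_eq hσ)]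
  exact lintegral_lintegral_swap (f := fun u x => ENNReal.ofReal (planeGaussian σ u x))
    (measurable_planeGaussian σ).ennreal_ofReal.aemeasurable

/-- The total error of the likelihood comparison is at most that of any other test. -/
lemma likelihood_test_le (L K : PlaneSegment) {σ : ℝ} (hσ : 0 < σ) {B : Set Plane}
    (hB : MeasurableSet B) :
    L.observationLaw σ {x | L.density σ x ≤ K.density σ x} +
      K.observationLaw σ {x | K.density σ x < L.density σ x} ≤
      L.observationLaw σ Bᶜ + K.observationLaw σ B := by
  have hC : MeasurableSet {x | K.density σ x < L.density σ x} :=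
    measurableSet_lt (K.measurable_density σ) (L.measurable_density σ)
  have hD : MeasurableSet {x | L.density σ x ≤ K.density σ x} :=
    measurableSet_le (L.measurable_density σ) (K.measurable_density σ)
  have hcompl : {x | K.density σ x < L.density σ x} = {x | L.density σ x ≤ K.density σ x}ᶜ := by
    ext x; simp
  -- Cut the likelihood regions along `B`, and `B` and its complement along the likelihood region.
  -- Where the two tests agree the terms coincide; elsewhere the left side carries the smaller
  -- density.
  rw [← measure_inter_add_sdiff _ hB, ← measure_inter_add_sdiff {x | K.density σ x < _} hB]
  rw [← measure_inter_add_sdiff Bᶜ hD, ← measure_inter_add_sdiff B hD]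
  have h1 : L.observationLaw σ ({x | L.density σ x ≤ K.density σ x} ∩ B) ≤
      K.observationLaw σ (B ∩ {x | L.density σ x ≤ K.density σ x}) := by
    rw [L.observationLaw_eq_withDensity hσ, K.observationLaw_eq_withDensity hσ, Set.inter_comm,
      withDensity_apply _ (hB.inter hD), withDensity_apply _ (hB.inter hD)]
    exact setLIntegral_mono' (hB.inter hD) fun x hx => ENNReal.ofReal_le_ofReal hx.2
  have h2 : K.observationLaw σ ({x | K.density σ x < L.density σ x} \ B) ≤
      L.observationLaw σ (Bᶜ \ {x | L.density σ x ≤ K.density σ x}) := by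
    rw [hcompl, Set.sdiff_eq, Set.sdiff_eq, Set.inter_comm, ← hcompl,
      L.observationLaw_eq_withDensity hσ, K.observationLaw_eq_withDensity hσ,
      withDensity_apply _ (hB.compl.inter hC), withDensity_apply _ (hB.compl.inter hC)]
    exact setLIntegral_mono' (hB.compl.inter hC) fun x hx => ENNReal.ofReal_le_ofReal hx.2.le
  have e1 : {x | L.density σ x ≤ K.density σ x} \ B = Bᶜ ∩ {x | L.density σ x ≤ K.density σ x} := by
    rw [Set.sdiff_eq, Set.inter_comm]
  have e2 : {x | K.density σ x < L.density σ x} ∩ B = B \ {x | L.density σ x ≤ K.density σ x} := by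
    rw [hcompl, Set.sdiff_eq, Set.inter_comm]
  rw [e1, e2]
  calc _ ≤ _ := add_le_add (add_le_add_left h1 _) (add_le_add_right h2 _)
    _ = _ := by ring

/-! ### Overlap of the two laws near the midpoint -/

lemma mid_apply (L : PlaneSegment) (i : Fin 2) : L.mid i = (L.fst i + L.snd i) / 2 := by
  rw [mid, midpoint_eq_smul_add]
  simp
  ring

lemma lineMap_eq (L : PlaneSegment) (t : ℝ) :
    AffineMap.lineMap L.fst L.snd t = L.mid + (t - 1 / 2) • (L.snd - L.fst) := by
  ext i
  simp [AffineMap.lineMap_apply, mid_apply]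
  ring

lemma length_sq (L : PlaneSegment) :
    L.length ^ 2 = (L.snd 0 - L.fst 0) ^ 2 + (L.snd 1 - L.fst 1) ^ 2 := by
  rw [length, dist_comm, EuclideanSpace.dist_sq_eq]
  simp [Real.dist_eq, sq_abs]

lemma observationLaw_eq_map (L : PlaneSegment) (σ : ℝ) :
    L.observationLaw σ = ((volume.restrict (Set.Icc (0 : ℝ) 1)).prod (stdGaussian Plane)).map
      (fun p => L.mid + (p.1 - 1 / 2) • (L.snd - L.fst) + σ • p.2) := by
  have h : (stdGaussian Plane) = (stdGaussian Plane).map id := Measure.map_id.symm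
  rw [observationLaw, uniform, h, Measure.map_prod_map _ _ L.measurable_param measurable_id,
    Measure.map_map (by fun_prop) (L.measurable_param.prodMap measurable_id), Measure.map_id]
  congr 1
  funext p
  simp only [Function.comp_apply, Prod.map_fst, Prod.map_snd, id_eq, lineMap_eq]

/-- From `|x - u|² ≤ 2 |x - m|² + 2 |u - m|²`. The first term shrinks the scale to `σ / √2`, whose
normalization costs the factor `1 / 2`; the second costs `exp (-(D ^ 2 / 4))`. -/
lemma planeGaussian_lower_bound {σ D : ℝ} (hσ : 0 < σ) {u m : Plane}
    (hum : (u 0 - m 0) ^ 2 + (u 1 - m 1) ^ 2 ≤ σ ^ 2 * D ^ 2 / 4) (x : Plane) :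
    Real.exp (-(D ^ 2 / 4)) / 2 * planeGaussian (σ / √2) m x ≤ planeGaussian σ u x := by
  have h2 : √2 ^ 2 = (2 : ℝ) := Real.sq_sqrt (by norm_num)
  rw [planeGaussian_eq hσ, planeGaussian_eq (by positivity), div_pow, h2]
  have h : Real.exp (-(D ^ 2 / 4)) / 2 * (1 / (2 * Real.pi * (σ ^ 2 / 2)) *
      Real.exp (-((x 0 - m 0) ^ 2 + (x 1 - m 1) ^ 2) / (2 * (σ ^ 2 / 2)))) =
      1 / (2 * Real.pi * σ ^ 2) * Real.exp (-(D ^ 2 / 4) +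
        -((x 0 - m 0) ^ 2 + (x 1 - m 1) ^ 2) / (2 * (σ ^ 2 / 2))) := by
    rw [Real.exp_add]; field_simp
  rw [h]
  refine mul_le_mul_of_nonneg_left (Real.exp_le_exp.2 ?_) (by positivity)
  have e : -(D ^ 2 / 4) + -((x 0 - m 0) ^ 2 + (x 1 - m 1) ^ 2) / (2 * (σ ^ 2 / 2)) =
      -(σ ^ 2 * D ^ 2 / 2 + 2 * ((x 0 - m 0) ^ 2 + (x 1 - m 1) ^ 2)) / (2 * σ ^ 2) := by
    field_simp
    ring
  rw [e]
  refine div_le_div_of_nonneg_right (neg_le_neg ?_) (by positivity)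
  nlinarith [sq_nonneg (x 0 - m 0 + (u 0 - m 0)), sq_nonneg (x 1 - m 1 + (u 1 - m 1))]

/-- An observation law dominates a Gaussian measure centered at the midpoint, of mass of the
order of `min σ 1`. -/
lemma smul_gaussian_le_observationLaw (L : PlaneSegment) {σ : ℝ} (hσ : 0 < σ) :
    ENNReal.ofReal (Real.exp (-(L.length ^ 2 / 4)) / 2 * min σ 1) •
      (stdGaussian Plane).map (fun y => L.mid + (σ / √2) • y) ≤ L.observationLaw σ := by
  refine Measure.le_iff.2 fun s hs => ?_
  set r := min σ 1
  have hr : 0 < r := lt_min hσ one_pos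
  have hm : Measurable (fun p : ℝ × Plane =>
      L.mid + (p.1 - 1 / 2) • (L.snd - L.fst) + σ • p.2) := by fun_prop
  rw [observationLaw_eq_map, Measure.map_apply hm hs, Measure.prod_apply (hm hs)]
  set a := ENNReal.ofReal (Real.exp (-(L.length ^ 2 / 4)) / 2)
  set γ := (stdGaussian Plane).map (fun y => L.mid + (σ / √2) • y) with hγ
  -- Keep only parameters within `r / 2` of the midpoint. This window has length `min σ 1`, and its
  -- points lie within `σ * L.length / 2` of the midpoint.
  have hJ : Set.Icc ((1 - r) / 2) ((1 + r) / 2) ⊆ Set.Icc (0 : ℝ) 1 := by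
    have : r ≤ 1 := min_le_right _ _
    exact Set.Icc_subset_Icc (by linarith) (by linarith)
  have hslice (t : ℝ) (ht : t ∈ Set.Icc ((1 - r) / 2) ((1 + r) / 2)) :
      a * γ s ≤ stdGaussian Plane (Prod.mk t ⁻¹' ((fun p : ℝ × Plane =>
        L.mid + (p.1 - 1 / 2) • (L.snd - L.fst) + σ • p.2) ⁻¹' s)) := by
    set u : Plane := L.mid + (t - 1 / 2) • (L.snd - L.fst) with hu
    have e : stdGaussian Plane (Prod.mk t ⁻¹' ((fun p : ℝ × Plane =>
        L.mid + (p.1 - 1 / 2) • (L.snd - L.fst) + σ • p.2) ⁻¹' s)) =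
        (stdGaussian Plane).map (fun y => u + σ • y) s := by
      rw [Measure.map_apply (by fun_prop) hs]; rfl
    rw [e, hγ, map_affine_stdGaussian hσ, map_affine_stdGaussian (by positivity),
      withDensity_apply _ hs, withDensity_apply _ hs, ← lintegral_const_mul]
    · refine lintegral_mono fun x => ?_
      simp only [a]
      rw [← ENNReal.ofReal_mul (by positivity)]
      refine ENNReal.ofReal_le_ofReal (planeGaussian_lower_bound hσ ?_ x)
      have htσ : (t - 1 / 2) ^ 2 ≤ σ ^ 2 / 4 := by
        have : r ≤ σ := min_le_left _ _
        nlinarith [ht.1, ht.2]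
      have hu' (i : Fin 2) : u i - L.mid i = (t - 1 / 2) * (L.snd i - L.fst i) := by
        simp [hu]
      rw [hu', hu', L.length_sq]
      nlinarith [sq_nonneg (L.snd 0 - L.fst 0), sq_nonneg (L.snd 1 - L.fst 1)]
    · exact (measurable_planeGaussian_right _ _).ennreal_ofReal
  calc _ = ∫⁻ t in Set.Icc ((1 - r) / 2) ((1 + r) / 2), a * γ s := by
        rw [setLIntegral_const, Real.volume_Icc, Measure.smul_apply, smul_eq_mul,
          ENNReal.ofReal_mul (by positivity)]
        have : (1 + r) / 2 - (1 - r) / 2 = r := by ring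
        rw [this]
        ring
    _ ≤ _ := (setLIntegral_mono' measurableSet_Icc hslice).trans (lintegral_mono_set hJ)

end PlaneSegment

/-- Two segments with a common midpoint have observation laws with a common upper bound whose mass
falls short of `2` by an amount of the order of `min σ 1`. -/
lemma exists_observationLaw_le (L : Label → PlaneSegment)
    (hlength : (L 0).length = (L 1).length) (hmid : (L 0).mid = (L 1).mid) :
    ∃ c : ℝ, 0 < c ∧ c ≤ 1 ∧ ∀ σ : ℝ, 0 < σ → ∃ M : Measure Plane, IsFiniteMeasure M ∧
      (∀ k, (L k).observationLaw σ ≤ M) ∧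
      M Set.univ / 2 ≤ ENNReal.ofReal (1 - c * min σ 1) := by
  set b := Real.exp (-((L 0).length ^ 2 / 4)) / 2 with hb
  have hb0 : 0 < b := by positivity
  have hb1 : b ≤ 1 := by
    have : Real.exp (-((L 0).length ^ 2 / 4)) ≤ 1 := Real.exp_le_one_iff.2 (by
      rw [neg_nonpos]; positivity)
    linarith
  refine ⟨b / 2, by positivity, by linarith, fun σ hσ => ?_⟩
  have hr : 0 < min σ 1 := lt_min hσ one_pos
  have hr1 : min σ 1 ≤ 1 := min_le_right _ _
  set ν := ENNReal.ofReal (b * min σ 1) •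
      (stdGaussian Plane).map (fun y => (L 0).mid + (σ / √2) • y) with hν
  have h0 : ν ≤ (L 0).observationLaw σ := (L 0).smul_gaussian_le_observationLaw hσ
  have h1 : ν ≤ (L 1).observationLaw σ := by
    rw [hν, hb, hlength, hmid]; exact (L 1).smul_gaussian_le_observationLaw hσ
  have hνfin : IsFiniteMeasure ν := isFiniteMeasure_of_le _ h0
  have hcancel : (L 1).observationLaw σ - ν + ν = (L 1).observationLaw σ :=
    Measure.sub_add_cancel_of_le h1
  -- The common part `ν` is counted once, so the mass is `2 - b * min σ 1`; halving it gives the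
  -- constant `b / 2`.
  refine ⟨(L 0).observationLaw σ + ((L 1).observationLaw σ - ν), ?_, ?_, ?_⟩
  · have := isFiniteMeasure_of_le _ (Measure.sub_le (μ := (L 1).observationLaw σ) (ν := ν))
    infer_instance
  · intro k
    fin_cases k
    · exact Measure.le_add_right le_rfl
    · calc (L 1).observationLaw σ = (L 1).observationLaw σ - ν + ν := hcancel.symm
        _ ≤ (L 1).observationLaw σ - ν + (L 0).observationLaw σ := by gcongr
        _ = _ := add_comm _ _
  · have : IsProbabilityMeasure ((stdGaussian Plane).map (fun y => (L 0).mid + (σ / √2) • y)) :=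
      Measure.isProbabilityMeasure_map (by fun_prop)
    have hmass : ν Set.univ = ENNReal.ofReal (b * min σ 1) := by simp [hν]
    have hrest : ((L 1).observationLaw σ - ν) Set.univ = ENNReal.ofReal (1 - b * min σ 1) := by
      rw [Measure.sub_apply MeasurableSet.univ h1, hmass, measure_univ,
        ENNReal.ofReal_sub _ (by positivity), ENNReal.ofReal_one]
    have hnonneg : b * min σ 1 ≤ 1 := mul_le_one₀ hb1 hr.le hr1
    rw [Measure.add_apply, hrest, measure_univ, ← ENNReal.ofReal_one,
      ← ENNReal.ofReal_add (by norm_num) (by linarith), ← ENNReal.ofReal_ofNat 2,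
      ← ENNReal.ofReal_div_of_pos (by norm_num)]
    exact ENNReal.ofReal_le_ofReal (by linarith)

/-! ### Likelihood error of order `σ`, by comparison with the closer line -/

lemma measurable_abs_apply_sub (a : Plane →L[ℝ] ℝ) (m : Plane) :
    Measurable (fun x => |a (x - m)|) :=
  (a.continuous.comp (continuous_id.sub continuous_const)).abs.measurable

/-- A point observed from a segment is, up to an error probability of order `σ`, closer to the line
of the segment than to another line, in oblique coordinates centered at the midpoint. -/
lemma PlaneSegment.observationLaw_coordinate_le (L : PlaneSegment) (a b : Plane →L[ℝ] ℝ)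
    (ha : a (L.snd - L.fst) = 1) (hb : b (L.snd - L.fst) = 0) {σ : ℝ} (hσ : 0 < σ) :
    L.observationLaw σ {x | |a (x - L.mid)| ≤ |b (x - L.mid)|} ≤
      ENNReal.ofReal (2 * (‖a‖ + ‖b‖) * (∫ y, ‖y‖ ∂stdGaussian Plane) * σ) := by
  have hm : Measurable (fun p : ℝ × Plane =>
      L.mid + (p.1 - 1 / 2) • (L.snd - L.fst) + σ • p.2) := by fun_prop
  have hs : MeasurableSet {x : Plane | |a (x - L.mid)| ≤ |b (x - L.mid)|} :=
    measurableSet_le (measurable_abs_apply_sub _ _) (measurable_abs_apply_sub _ _)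
  have hint : Integrable (fun y : Plane => ‖y‖) (stdGaussian Plane) :=
    (IsGaussian.integrable_id (μ := stdGaussian Plane)).norm
  rw [L.observationLaw_eq_map, Measure.map_apply hm hs, Measure.prod_apply_symm (hm hs)]
  calc _ ≤ ∫⁻ y, ENNReal.ofReal (2 * (‖a‖ + ‖b‖) * σ * ‖y‖) ∂stdGaussian Plane := by
        refine lintegral_mono fun y => ?_
        refine (Measure.restrict_apply_le _ _).trans ?_
        -- For fixed noise `y`, the coordinates are `t - 1 / 2 + σ * a y` and `σ * b y`; an error
        -- confines `t` to a window around `1 / 2`.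
        have hsub : (fun t : ℝ => (t, y)) ⁻¹' ((fun p : ℝ × Plane =>
            L.mid + (p.1 - 1 / 2) • (L.snd - L.fst) + σ • p.2) ⁻¹'
            {x : Plane | |a (x - L.mid)| ≤ |b (x - L.mid)|}) ⊆
            Set.Icc (1 / 2 - (‖a‖ + ‖b‖) * σ * ‖y‖) (1 / 2 + (‖a‖ + ‖b‖) * σ * ‖y‖) := by
          intro t ht
          have ht' : |t - 1 / 2 + σ * a y| ≤ |σ * b y| := by
            have hsub : L.mid + (t - 1 / 2) • (L.snd - L.fst) + σ • y - L.mid =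
              (t - 1 / 2) • (L.snd - L.fst) + σ • y := by abel
            have hmem : |a (L.mid + (t - 1 / 2) • (L.snd - L.fst) + σ • y - L.mid)| ≤
              |b (L.mid + (t - 1 / 2) • (L.snd - L.fst) + σ • y - L.mid)| := ht
            rw [hsub, map_add, map_add, map_smul, map_smul, map_smul, map_smul, ha, hb] at hmem
            simpa only [smul_eq_mul, mul_one, mul_zero, zero_add] using hmem
          have h1 : |t - 1 / 2| ≤ |t - 1 / 2 + σ * a y| + |σ * a y| := by
            have := abs_sub (t - 1 / 2 + σ * a y) (σ * a y)
            simpa using this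
          rw [abs_mul, abs_of_pos hσ] at ht' h1
          have ha' : |a y| ≤ ‖a‖ * ‖y‖ := a.le_opNorm y
          have hb' : |b y| ≤ ‖b‖ * ‖y‖ := b.le_opNorm y
          have : |t - 1 / 2| ≤ (‖a‖ + ‖b‖) * σ * ‖y‖ := by nlinarith
          have := abs_le.1 this
          exact ⟨by linarith, by linarith⟩
        refine (measure_mono hsub).trans ?_
        rw [Real.volume_Icc]
        exact ENNReal.ofReal_le_ofReal (by linarith)
    _ = _ := by
        rw [← ofReal_integral_eq_lintegral_ofReal (hint.const_mul _)
          (Eventually.of_forall fun y => by positivity), integral_const_mul]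
        ring_nf

/-- The cross product of the directions of two different segments of equal length with a common
midpoint does not vanish. -/
lemma cross_ne_zero (L : Label → PlaneSegment)
    (hlength : (L 0).length = (L 1).length) (hmid : (L 0).mid = (L 1).mid)
    (hcross : (L 0).carrier ∩ (L 1).carrier = {(L 0).mid}) :
    ((L 0).snd 0 - (L 0).fst 0) * ((L 1).snd 1 - (L 1).fst 1) -
      ((L 0).snd 1 - (L 0).fst 1) * ((L 1).snd 0 - (L 1).fst 0) ≠ 0 := by
  intro h
  have hl : (L 0).length ^ 2 = (L 1).length ^ 2 := by rw [hlength]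
  rw [PlaneSegment.length_sq, PlaneSegment.length_sq] at hl
  have hm (i : Fin 2) : (L 0).fst i + (L 0).snd i = (L 1).fst i + (L 1).snd i := by
    have := congrArg (fun p : Plane => p i) hmid
    simp only [PlaneSegment.mid_apply] at this
    linarith
  have hend : (L 1).fst ∈ (L 0).carrier := by
    -- Parallel segments with equal length and midpoint share their endpoints. The identity `key`
    -- expresses the product of squared distances from `(L 1).fst` to the endpoints of `L 0` through
    -- the difference of squared lengths and the cross product, both zero. A shared endpoint must
    -- then be the midpoint, against nondegeneracy.
    have hprod : (((L 1).fst 0 - (L 0).fst 0) ^ 2 + ((L 1).fst 1 - (L 0).fst 1) ^ 2) *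
        (((L 1).fst 0 - (L 0).snd 0) ^ 2 + ((L 1).fst 1 - (L 0).snd 1) ^ 2) = 0 := by
      have e0 : (L 1).snd 0 = (L 0).fst 0 + (L 0).snd 0 - (L 1).fst 0 := by linarith [hm 0]
      have e1 : (L 1).snd 1 = (L 0).fst 1 + (L 0).snd 1 - (L 1).fst 1 := by linarith [hm 1]
      rw [e0, e1] at h hl
      generalize (L 0).fst 0 = p0 at *
      generalize (L 0).fst 1 = p1 at *
      generalize (L 0).snd 0 = q0 at *
      generalize (L 0).snd 1 = q1 at *
      generalize (L 1).fst 0 = r0 at *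
      generalize (L 1).fst 1 = r1 at *
      have key : 16 * (((r0 - p0) ^ 2 + (r1 - p1) ^ 2) * ((r0 - q0) ^ 2 + (r1 - q1) ^ 2)) =
        ((q0 - p0) ^ 2 + (q1 - p1) ^ 2 -
          ((p0 + q0 - r0 - r0) ^ 2 + (p1 + q1 - r1 - r1) ^ 2)) ^ 2 +
        4 * ((q0 - p0) * (p1 + q1 - r1 - r1) - (q1 - p1) * (p0 + q0 - r0 - r0)) ^ 2 := by ring
      rw [h, hl] at key
      linarith
    have hsq {p q : Plane} (h : (p 0 - q 0) ^ 2 + (p 1 - q 1) ^ 2 = 0) : p = q := by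
      have h' := (add_eq_zero_iff_of_nonneg (sq_nonneg _) (sq_nonneg _)).1 h
      ext i
      fin_cases i
      · exact sub_eq_zero.1 (pow_eq_zero_iff two_ne_zero |>.1 h'.1)
      · exact sub_eq_zero.1 (pow_eq_zero_iff two_ne_zero |>.1 h'.2)
    rcases mul_eq_zero.1 hprod with h | h
    · rw [hsq h]; exact left_mem_segment _ _ _
    · rw [hsq h]; exact right_mem_segment _ _ _
  have hmem : (L 1).fst ∈ (L 0).carrier ∩ (L 1).carrier := ⟨hend, left_mem_segment _ _ _⟩
  rw [hcross, hmid, Set.mem_singleton_iff] at hmem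
  refine (L 1).ne ?_
  ext i
  have := congrArg (fun p : Plane => p i) hmem
  simp only [PlaneSegment.mid_apply] at this
  linarith

/-- The dual basis of `v, w`, by Cramer's rule. -/
lemma exists_oblique_coordinates {v w : Plane} (h : v 0 * w 1 - v 1 * w 0 ≠ 0) :
    ∃ a b : Plane →L[ℝ] ℝ, a v = 1 ∧ a w = 0 ∧ b v = 0 ∧ b w = 1 := by
  set d := v 0 * w 1 - v 1 * w 0 with hd
  refine ⟨(w 1 / d) • EuclideanSpace.proj 0 - (w 0 / d) • EuclideanSpace.proj 1,
    (v 0 / d) • EuclideanSpace.proj 1 - (v 1 / d) • EuclideanSpace.proj 0, ?_, ?_, ?_, ?_⟩ <;>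
  · simp
    field_simp
    try rw [hd]
    try ring

/-- The total error of the likelihood comparison is of order `σ`. -/
lemma exists_likelihood_error_le (L : Label → PlaneSegment)
    (hlength : (L 0).length = (L 1).length) (hmid : (L 0).mid = (L 1).mid)
    (hcross : (L 0).carrier ∩ (L 1).carrier = {(L 0).mid}) :
    ∃ C : ℝ, 0 ≤ C ∧ ∀ σ : ℝ, 0 < σ →
      (L 0).observationLaw σ {x | (L 0).density σ x ≤ (L 1).density σ x} +
      (L 1).observationLaw σ {x | (L 1).density σ x < (L 0).density σ x} ≤
        ENNReal.ofReal (C * σ) := by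
  obtain ⟨a, b, hav, haw, hbv, hbw⟩ := exists_oblique_coordinates
    (v := (L 0).snd - (L 0).fst) (w := (L 1).snd - (L 1).fst)
    (by simpa using cross_ne_zero L hlength hmid hcross)
  obtain ⟨I, hI⟩ : ∃ I, I = ∫ y, ‖y‖ ∂stdGaussian Plane := ⟨_, rfl⟩
  have hI0 : 0 ≤ I := hI ▸ integral_nonneg fun y => norm_nonneg y
  have hE0 : 0 ≤ 2 * (‖a‖ + ‖b‖) * I := by positivity
  refine ⟨2 * (‖a‖ + ‖b‖) * I + 2 * (‖a‖ + ‖b‖) * I, add_nonneg hE0 hE0, fun σ hσ => ?_⟩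
  -- The competing test declares the first segment where the coordinate along it dominates.
  have hB : MeasurableSet {x : Plane | |b (x - (L 0).mid)| ≤ |a (x - (L 0).mid)|} :=
    measurableSet_le (measurable_abs_apply_sub _ _) (measurable_abs_apply_sub _ _)
  refine ((L 0).likelihood_test_le (L 1) hσ hB).trans ?_
  rw [add_mul, ENNReal.ofReal_add (mul_nonneg hE0 hσ.le) (mul_nonneg hE0 hσ.le), hI]
  refine add_le_add ?_ ?_
  · have hsub : {x : Plane | |b (x - (L 0).mid)| ≤ |a (x - (L 0).mid)|}ᶜ ⊆
        {x | |a (x - (L 0).mid)| ≤ |b (x - (L 0).mid)|} := by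
      intro x hx
      simp only [Set.mem_compl_iff, Set.mem_ofPred_eq, not_le] at hx ⊢
      exact hx.le
    exact (measure_mono hsub).trans ((L 0).observationLaw_coordinate_le a b hav hbv hσ)
  · rw [hmid, add_comm ‖a‖]
    exact (L 1).observationLaw_coordinate_le b a hbw haw hσ

/-! ### From the error at one point to recovery -/

lemma mle_error_le {N : ℕ} (L : Label → PlaneSegment) (σ : ℝ) {q : ℝ≥0∞}
    (hq : (L 0).observationLaw σ {x | (L 0).density σ x ≤ (L 1).density σ x} +
      (L 1).observationLaw σ {x | (L 1).density σ x < (L 0).density σ x} ≤ q) (i : Fin N) :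
    jointLaw L σ (mle N L σ) {ω | ω.2 i ≠ ω.1.1 i} ≤ q := by
  rw [jointLaw_apply L σ _ (fun y z => y i ≠ z i)]
  have hz (z : Fin N → Label) :
      ∫⁻ x, (mle N L σ).kernel x {y | y i ≠ z i} ∂glmmGiven L σ z ≤ q := by
    have hS : MeasurableSet {y : Fin N → Label | y i ≠ z i} := (Set.to_countable _).measurableSet
    have hle := measurableSet_le ((L 0).measurable_density σ) ((L 1).measurable_density σ)
    have hlt := measurableSet_lt ((L 1).measurable_density σ) ((L 0).measurable_density σ)
    have h1 : ∫⁻ x, (mle N L σ).kernel x {y | y i ≠ z i} ∂glmmGiven L σ z =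
        glmmGiven L σ z (mleLabels N L σ ⁻¹' {y | y i ≠ z i}) := by
      simp only [mle, Estimator.ofMap]
      simp_rw [Kernel.deterministic_apply' (measurable_mleLabels N L σ) _ hS]
      exact (lintegral_indicator_one (measurable_mleLabels N L σ hS) :)
    have heval : MeasurePreserving (Function.eval i) (glmmGiven L σ z)
        ((L (z i)).observationLaw σ) :=
      measurePreserving_eval (fun i => (L (z i)).observationLaw σ) i
    rw [h1]
    obtain hk | hk : z i = 0 ∨ z i = 1 := by
      generalize z i = k
      revert k
      decide
    · rw [hk] at heval
      calc _ ≤ glmmGiven L σ z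
            (Function.eval i ⁻¹' {x | (L 0).density σ x ≤ (L 1).density σ x}) := by
            refine measure_mono fun x hx => ?_
            simp only [Set.mem_preimage, Set.mem_ofPred_eq, mleLabels, hk, Function.eval] at hx ⊢
            by_contra hcon
            exact hx (if_pos (not_le.1 hcon))
        _ = _ := heval.measure_preimage hle.nullMeasurableSet
        _ ≤ q := le_self_add.trans hq
    · rw [hk] at heval
      calc _ ≤ glmmGiven L σ z
            (Function.eval i ⁻¹' {x | (L 1).density σ x < (L 0).density σ x}) := by
            refine measure_mono fun x hx => ?_
            simp only [Set.mem_preimage, Set.mem_ofPred_eq, mleLabels, hk, Function.eval] at hx ⊢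
            by_contra hcon
            exact hx (if_neg hcon)
        _ = _ := heval.measure_preimage hlt.nullMeasurableSet
        _ ≤ q := le_add_self.trans hq
  calc _ ≤ (2 ^ N)⁻¹ * ∑ z : Fin N → Label, q := by gcongr with z; exact hz z
    _ = q := by
      rw [Finset.sum_const, Finset.card_univ, Fintype.card_fun, Fintype.card_fin, Fintype.card_fin,
        nsmul_eq_mul, ← mul_assoc]
      push_cast
      rw [ENNReal.inv_mul_cancel (by simp) (by simp), one_mul]

lemma hamStar_le_card {N : ℕ} (y z : Fin N → Label) :
    hamStar y z ≤ (Finset.univ.filter fun i => y i ≠ z i).card :=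
  Finset.inf'_le (fun π : Equiv.Perm Label => hammingDist y (fun i => π (z i)))
    (Finset.mem_univ 1)

lemma hamStar_le {N : ℕ} (y z : Fin N → Label) : hamStar y z ≤ N :=
  (hamStar_le_card y z).trans ((Finset.card_le_univ _).trans_eq (Fintype.card_fin N))

lemma lintegral_hamStar_le {N : ℕ} (L : Label → PlaneSegment) (σ : ℝ) (e : Estimator N)
    {q : ℝ≥0∞} (hq : ∀ i, jointLaw L σ e {ω | ω.2 i ≠ ω.1.1 i} ≤ q) :
    ∫⁻ ω, (hamStar ω.2 ω.1.1 : ℝ≥0∞) ∂jointLaw L σ e ≤ N * q := by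
  have hmeas (i : Fin N) := measurableSet_outcome (fun y z : Fin N → Label => y i ≠ z i)
  calc _ ≤ ∫⁻ ω, ∑ i, Set.indicator {ω | ω.2 i ≠ ω.1.1 i} 1 ω ∂jointLaw L σ e := by
        refine lintegral_mono fun ω => ?_
        refine (Nat.cast_le.2 (hamStar_le_card ω.2 ω.1.1)).trans_eq ?_
        simp [Set.indicator_apply, Finset.sum_ite]
    _ = ∑ i, jointLaw L σ e {ω | ω.2 i ≠ ω.1.1 i} := by
        rw [lintegral_finsetSum _ fun i _ => measurable_one.indicator (hmeas i)]
        exact Finset.sum_congr rfl fun i _ => lintegral_indicator_one (hmeas i)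
    _ ≤ ∑ i : Fin N, q := Finset.sum_le_sum fun i _ => hq i
    _ = N * q := by simp

lemma measurable_hamStar (N : ℕ) :
    Measurable (fun ω : ((Fin N → Label) × (Fin N → Plane)) × (Fin N → Label) =>
      hamStar ω.2 ω.1.1) := by
  have h : Measurable (fun p : (Fin N → Label) × (Fin N → Label) => hamStar p.1 p.2) :=
    measurable_of_countable _
  exact h.comp (f := fun ω : ((Fin N → Label) × (Fin N → Plane)) × (Fin N → Label) =>
    (ω.2, ω.1.1)) (by fun_prop)

/-- Markov's inequality at level `1`, since `hamStar` is an integer. -/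
lemma one_sub_le_exact_success {N : ℕ} (L : Label → PlaneSegment) (σ : ℝ) (e : Estimator N)
    {q : ℝ≥0∞} (hq : ∀ i, jointLaw L σ e {ω | ω.2 i ≠ ω.1.1 i} ≤ q) :
    1 - N * q ≤ jointLaw L σ e {ω | hamStar ω.2 ω.1.1 = 0} := by
  have hS := measurableSet_outcome (fun y z : Fin N → Label => hamStar y z = 0)
  rw [← prob_add_prob_compl (μ := jointLaw L σ e) hS]
  refine tsub_le_iff_right.2 (add_le_add_right ?_ _)
  have hmark := mul_meas_ge_le_lintegral (μ := jointLaw L σ e)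
    ((measurable_from_nat (f := fun n : ℕ => (n : ℝ≥0∞))).comp (measurable_hamStar N)) 1
  rw [one_mul] at hmark
  refine (measure_mono fun ω hω => ?_).trans (hmark.trans (lintegral_hamStar_le L σ e hq))
  simp only [Set.mem_compl_iff, Set.mem_ofPred_eq, Function.comp_apply] at hω ⊢
  exact_mod_cast Nat.one_le_iff_ne_zero.2 hω

lemma one_sub_le_almost_exact_success {N : ℕ} (hN : N ≠ 0) (L : Label → PlaneSegment) (σ : ℝ)
    (e : Estimator N) {q : ℝ≥0∞} (hq : ∀ i, jointLaw L σ e {ω | ω.2 i ≠ ω.1.1 i} ≤ q)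
    {ε : ℝ} (hε : 0 < ε) :
    1 - q / ENNReal.ofReal ε ≤
      jointLaw L σ e {ω | (hamStar ω.2 ω.1.1 : ℝ) / N ≤ ε} := by
  have hS := measurableSet_outcome (fun y z : Fin N → Label => (hamStar y z : ℝ) / N ≤ ε)
  rw [← prob_add_prob_compl (μ := jointLaw L σ e) hS]
  refine tsub_le_iff_right.2 (add_le_add_right ?_ _)
  have hNpos : (0 : ℝ) < N := by positivity
  have hmark := (mul_meas_ge_le_lintegral (μ := jointLaw L σ e)
    ((measurable_from_nat (f := fun n : ℕ => (n : ℝ≥0∞))).comp (measurable_hamStar N))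
    (N * ENNReal.ofReal ε)).trans (lintegral_hamStar_le L σ e hq)
  rw [mul_assoc, ENNReal.mul_le_mul_iff_right (by simpa using hN) (by simp)] at hmark
  rw [ENNReal.le_div_iff_mul_le (by simp [hε]) (by simp), mul_comm]
  refine le_trans ?_ hmark
  gcongr
  intro ω hω
  simp only [Set.mem_compl_iff, Set.mem_ofPred_eq, Function.comp_apply, not_le] at hω ⊢
  rw [lt_div_iff₀ hNpos] at hω
  rw [← ENNReal.ofReal_natCast, ← ENNReal.ofReal_natCast, ← ENNReal.ofReal_mul hNpos.le]
  exact ENNReal.ofReal_le_ofReal (by linarith)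

/-! ### Quantitative impossibility -/

/-- If the observation laws overlap by `δ`, no estimator is almost exact with high probability. -/
lemma almost_exact_success_le {N : ℕ} (hN : 2 ≤ N) (L : Label → PlaneSegment) (σ : ℝ)
    (e : Estimator N) (M : Measure Plane) [IsFiniteMeasure M]
    (hM : ∀ k, (L k).observationLaw σ ≤ M) {δ : ℝ} (hδ0 : 0 ≤ δ) (hδ : δ ≤ 1)
    (hmass : M Set.univ / 2 ≤ ENNReal.ofReal (1 - δ)) :
    (jointLaw L σ e).real {ω | (hamStar ω.2 ω.1.1 : ℝ) / N ≤ δ / 8} ≤ 1 - δ / 8 := by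
  set P := jointLaw L σ e
  have hNpos : (0 : ℝ) < N := by positivity
  have hS := measurableSet_outcome (fun y z : Fin N → Label => (hamStar y z : ℝ) / N ≤ δ / 8)
  set bad : Set (((Fin N → Label) × (Fin N → Plane)) × (Fin N → Label)) :=
    {ω | (hamStar ω.2 ω.1.1 : ℝ) / N ≤ δ / 8}ᶜ with hbad
  have hbad_meas : MeasurableSet bad := hS.compl
  let T (p : Fin N × Fin N) : Set (((Fin N → Label) × (Fin N → Plane)) × (Fin N → Label)) :=
    {ω | (ω.2 p.1 = ω.1.1 p.1 ↔ ω.2 p.2 = ω.1.1 p.2)}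
  have hT (p) : MeasurableSet (T p) :=
    measurableSet_outcome (fun y z : Fin N → Label => (y p.1 = z p.1 ↔ y p.2 = z p.2))
  have hTp (p) (hp : p ∈ Finset.univ.offDiag) : δ ≤ P.real (T p)ᶜ := by
    have h := (pair_agreement_le L σ e M hM (Finset.mem_offDiag.1 hp).2.2).trans hmass
    have h' : P.real (T p) ≤ 1 - δ := ENNReal.toReal_le_of_le_ofReal (by linarith) h
    rw [probReal_compl_eq_one_sub (hT p)]
    linarith
  -- Expectations give `N * (N - 1) * δ ≤ 2 * N ^ 2 * (δ / 8 + P.real bad)`. As `N - 1 ≥ N / 2`,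
  -- this forces `P.real bad ≥ δ / 8`.
  have hpoint (ω) : ∑ p ∈ (Finset.univ : Finset (Fin N)).offDiag, (T p)ᶜ.indicator (fun _ => (1 : ℝ)) ω ≤
      2 * N * (N * (δ / 8) + N * bad.indicator (fun _ => (1 : ℝ)) ω) := by
    have h1 : ∑ p ∈ (Finset.univ : Finset (Fin N)).offDiag, (T p)ᶜ.indicator (fun _ => (1 : ℝ)) ω ≤
        2 * N * hamStar ω.2 ω.1.1 := by
      have hcount : (((Finset.univ ×ˢ Finset.univ).filter (fun p : Fin N × Fin N =>
          ¬ (ω.2 p.1 = ω.1.1 p.1 ↔ ω.2 p.2 = ω.1.1 p.2))).card : ℝ) ≤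
          2 * N * hamStar ω.2 ω.1.1 := by exact_mod_cast hamStar_count ω.2 ω.1.1
      refine le_trans ?_ hcount
      rw [Finset.card_eq_sum_ones, Finset.sum_filter]
      push_cast
      refine (Finset.sum_le_sum_of_subset_of_nonneg (t := Finset.univ ×ˢ Finset.univ)
        (fun p hp => by simp) fun p _ _ => Set.indicator_nonneg (fun _ _ => zero_le_one) _).trans_eq
        (Finset.sum_congr rfl fun p _ => ?_)
      simp [Set.indicator_apply, T]
    refine h1.trans (mul_le_mul_of_nonneg_left ?_ (by positivity))
    by_cases hω : ω ∈ bad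
    · have : (hamStar ω.2 ω.1.1 : ℝ) ≤ N := by exact_mod_cast hamStar_le _ _
      rw [Set.indicator_of_mem hω, mul_one]
      have : 0 ≤ N * (δ / 8) := by positivity
      linarith
    · rw [Set.indicator_of_notMem hω, mul_zero, add_zero]
      simp only [hbad, Set.mem_compl_iff, Set.mem_ofPred_eq, not_not] at hω
      rw [div_le_iff₀ hNpos] at hω
      linarith
  have hind {s : Set (((Fin N → Label) × (Fin N → Plane)) × (Fin N → Label))}
      (hs : MeasurableSet s) : Integrable (s.indicator (fun _ => (1 : ℝ))) P :=
    (integrable_const 1).indicator hs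
  have hone {s : Set (((Fin N → Label) × (Fin N → Plane)) × (Fin N → Label))}
      (hs : MeasurableSet s) : ∫ ω, s.indicator (fun _ => (1 : ℝ)) ω ∂P = P.real s :=
    integral_indicator_one hs
  have hint := integral_mono (μ := P) (integrable_finsetSum _ fun p _ => hind (hT p).compl)
    (((integrable_const _).add ((hind hbad_meas).const_mul _)).const_mul _) hpoint
  rw [integral_finsetSum _ fun p _ => hind (hT p).compl, integral_const_mul,
    integral_add' (integrable_const _) ((hind hbad_meas).const_mul _), integral_const_mul, integral_const_mul,
    hone hbad_meas, integral_const, probReal_univ, one_smul] at hint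
  simp_rw [hone (hT _).compl] at hint
  have hlow : ((N * N - N : ℕ) : ℝ) * δ ≤
      ∑ p ∈ (Finset.univ : Finset (Fin N)).offDiag, P.real (T p)ᶜ := by
    have := Finset.card_nsmul_le_sum _ _ _ hTp
    rwa [Finset.offDiag_card, Finset.card_univ, Fintype.card_fin, nsmul_eq_mul] at this
  rw [Nat.cast_sub (Nat.le_mul_self N)] at hlow
  push_cast at hlow
  have hcompl : P.real bad = 1 - P.real {ω | (hamStar ω.2 ω.1.1 : ℝ) / N ≤ δ / 8} :=
    probReal_compl_eq_one_sub hS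
  have hN2 : (2 : ℝ) ≤ N := by exact_mod_cast hN
  have hmain : N * ((N - 1) * δ) ≤ N * (N * (2 * (δ / 8 + P.real bad))) := by
    calc _ = ((N : ℝ) * N - N) * δ := by ring
      _ ≤ _ := hlow.trans hint
      _ = _ := by ring
  have hmain := le_of_mul_le_mul_left hmain hNpos
  have hhalf : N * (δ / 2) ≤ (N - 1) * δ := by nlinarith
  have := le_of_mul_le_mul_left (hhalf.trans hmain) hNpos
  linarith

lemma exact_success_le_exp {N : ℕ} (hN : 2 ≤ N) (L : Label → PlaneSegment) (σ : ℝ)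
    (e : Estimator N) (M : Measure Plane) [IsFiniteMeasure M]
    (hM : ∀ k, (L k).observationLaw σ ≤ M) {δ : ℝ} (hδ0 : 0 ≤ δ)
    (hmass : M Set.univ / 2 ≤ ENNReal.ofReal (1 - δ)) :
    jointLaw L σ e {ω | hamStar ω.2 ω.1.1 = 0} ≤ ENNReal.ofReal (Real.exp (-(N * δ / 2))) := by
  obtain ⟨n, rfl⟩ : ∃ n, N = n + 1 := ⟨N - 1, by omega⟩
  calc _ ≤ (M Set.univ / 2) ^ n := exact_success_le L σ e M hM
    _ ≤ ENNReal.ofReal (Real.exp (-δ)) ^ n := by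
      gcongr
      refine hmass.trans (ENNReal.ofReal_le_ofReal ?_)
      linarith [Real.add_one_le_exp (-δ)]
    _ = ENNReal.ofReal (Real.exp (n * -δ)) := by
      rw [← ENNReal.ofReal_pow (Real.exp_pos _).le, Real.exp_nat_mul]
    _ ≤ _ := by
      -- The exponent `n = N - 1` is at least `N / 2`.
      refine ENNReal.ofReal_le_ofReal (Real.exp_le_exp.2 ?_)
      have : (1 : ℝ) ≤ n := by exact_mod_cast (by omega : 1 ≤ n)
      push_cast
      nlinarith

/-! ### Asymptotics in `N` -/

lemma mle_exactRecovery (L : Label → PlaneSegment)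
    (hlength : (L 0).length = (L 1).length) (hmid : (L 0).mid = (L 1).mid)
    (σ : ℕ → ℝ) (hσ : ∀ N, 1 ≤ N → 0 < σ N)
    (hcross : (L 0).carrier ∩ (L 1).carrier = {(L 0).mid})
    (h : σ =o[atTop] (fun N : ℕ => 1 / (N : ℝ))) :
    ExactRecovery L σ (fun N => mle N L (σ N)) := by
  obtain ⟨C, hC, hbound⟩ := exists_likelihood_error_le L hlength hmid hcross
  have hlim : Tendsto (fun N : ℕ => (N : ℝ) * (C * σ N)) atTop (𝓝 0) := by
    have := (h.tendsto_div_nhds_zero).const_mul C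
    rw [mul_zero] at this
    refine this.congr fun N => ?_
    rw [one_div, div_inv_eq_mul]
    ring
  have hlow : Tendsto (fun N : ℕ => 1 - ENNReal.ofReal ((N : ℝ) * (C * σ N))) atTop (𝓝 1) := by
    have := ENNReal.Tendsto.sub (tendsto_const_nhds (x := (1 : ℝ≥0∞)))
      (ENNReal.tendsto_ofReal hlim) (Or.inl ENNReal.one_ne_top)
    simpa using this
  refine tendsto_of_tendsto_of_tendsto_of_le_of_le' hlow tendsto_const_nhds ?_
    (Eventually.of_forall fun N => prob_le_one)
  filter_upwards [eventually_ge_atTop 1] with N hN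
  have := one_sub_le_exact_success L (σ N) (mle N L (σ N))
    (mle_error_le L (σ N) (hbound (σ N) (hσ N hN)))
  rwa [ENNReal.ofReal_mul (Nat.cast_nonneg N), ENNReal.ofReal_natCast]

lemma mle_almostExactRecovery (L : Label → PlaneSegment)
    (hlength : (L 0).length = (L 1).length) (hmid : (L 0).mid = (L 1).mid)
    (σ : ℕ → ℝ) (hσ : ∀ N, 1 ≤ N → 0 < σ N)
    (hcross : (L 0).carrier ∩ (L 1).carrier = {(L 0).mid})
    (h : σ =o[atTop] (fun _ : ℕ => (1 : ℝ))) :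
    AlmostExactRecovery L σ (fun N => mle N L (σ N)) := by
  intro ε hε
  obtain ⟨C, hC, hbound⟩ := exists_likelihood_error_le L hlength hmid hcross
  have hlim : Tendsto (fun N : ℕ => C * σ N / ε) atTop (𝓝 0) := by
    have := (((isLittleO_one_iff ℝ).1 h).const_mul C).div_const ε
    simpa using this
  have hlow : Tendsto (fun N : ℕ => 1 - ENNReal.ofReal (C * σ N / ε)) atTop (𝓝 1) := by
    have := ENNReal.Tendsto.sub (tendsto_const_nhds (x := (1 : ℝ≥0∞)))
      (ENNReal.tendsto_ofReal hlim) (Or.inl ENNReal.one_ne_top)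
    simpa using this
  refine tendsto_of_tendsto_of_tendsto_of_le_of_le' hlow tendsto_const_nhds ?_
    (Eventually.of_forall fun N => prob_le_one)
  filter_upwards [eventually_ge_atTop 1] with N hN
  have := one_sub_le_almost_exact_success (by omega) L (σ N) (mle N L (σ N))
    (mle_error_le L (σ N) (hbound (σ N) (hσ N hN))) hε
  rwa [ENNReal.ofReal_div_of_pos hε]

lemma not_exactRecovery (L : Label → PlaneSegment)
    (hlength : (L 0).length = (L 1).length) (hmid : (L 0).mid = (L 1).mid)
    (σ : ℕ → ℝ) (hσ : ∀ N, 1 ≤ N → 0 < σ N)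
    (h : ¬ σ =o[atTop] (fun N : ℕ => 1 / (N : ℝ)))
    (e : ∀ N, Estimator N) : ¬ ExactRecovery L σ e := by
  intro hrec
  obtain ⟨c, hc, -, hoverlap⟩ := exists_observationLaw_le L hlength hmid
  -- Only infinitely many `N` satisfy the lower bound, which suffices: along them success stays
  -- below a fixed constant less than `1`.
  obtain ⟨k, hk, hfreq⟩ : ∃ k : ℝ, 0 < k ∧ ∃ᶠ N : ℕ in atTop, k * (1 / (N : ℝ)) < |σ N| := by
    rw [isLittleO_iff] at h
    push Not at h
    obtain ⟨k, hk, hf⟩ := h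
    refine ⟨k, hk, hf.mono fun N hN => ?_⟩
    simpa using hN
  set ρ := c * min k 1 with hρ
  have hρ0 : 0 < ρ := mul_pos hc (lt_min hk one_pos)
  have hlt : ENNReal.ofReal (Real.exp (-(ρ / 2))) < 1 := by
    rw [← ENNReal.ofReal_one, ENNReal.ofReal_lt_ofReal_iff one_pos]
    rw [Real.exp_lt_one_iff]
    linarith
  obtain ⟨N, hN, hgt, hN2⟩ := (hfreq.and_eventually
    ((hrec.eventually (lt_mem_nhds hlt)).and (eventually_ge_atTop 2))).exists
  have hσN := hσ N (by omega)
  obtain ⟨M, hMfin, hM, hmass⟩ := hoverlap (σ N) hσN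
  have hmin : 0 < min (σ N) 1 := lt_min hσN one_pos
  refine absurd (exact_success_le_exp hN2 L (σ N) (e N) M hM (by positivity) hmass)
    (not_le.2 (lt_of_le_of_lt (ENNReal.ofReal_le_ofReal (Real.exp_le_exp.2 ?_)) hgt))
  have hNpos : (0 : ℝ) < N := by positivity
  rw [abs_of_pos hσN, mul_one_div, div_lt_iff₀ hNpos] at hN
  have hN1 : (1 : ℝ) ≤ N := by exact_mod_cast (by omega : 1 ≤ N)
  have hkey : min k 1 ≤ N * min (σ N) 1 := by
    rw [mul_min_of_nonneg _ _ hNpos.le, mul_one]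
    exact min_le_min (by linarith) hN1
  have : ρ ≤ N * (c * min (σ N) 1) := by
    calc ρ ≤ c * (N * min (σ N) 1) := mul_le_mul_of_nonneg_left hkey hc.le
      _ = _ := by ring
  linarith

lemma not_almostExactRecovery (L : Label → PlaneSegment)
    (hlength : (L 0).length = (L 1).length) (hmid : (L 0).mid = (L 1).mid)
    (σ : ℕ → ℝ) (hσ : ∀ N, 1 ≤ N → 0 < σ N)
    (h : ¬ σ =o[atTop] (fun _ : ℕ => (1 : ℝ)))
    (e : ∀ N, Estimator N) : ¬ AlmostExactRecovery L σ e := by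
  intro hrec
  obtain ⟨c, hc, hc1, hoverlap⟩ := exists_observationLaw_le L hlength hmid
  obtain ⟨k, hk, hfreq⟩ : ∃ k : ℝ, 0 < k ∧ ∃ᶠ N : ℕ in atTop, k < |σ N| := by
    rw [isLittleO_iff] at h
    push Not at h
    obtain ⟨k, hk, hf⟩ := h
    refine ⟨k, hk, hf.mono fun N hN => ?_⟩
    simpa using hN
  set δ := c * min k 1 with hδ
  have hδ0 : 0 < δ := mul_pos hc (lt_min hk one_pos)
  have hδ1 : δ ≤ 1 := mul_le_one₀ hc1 (lt_min hk one_pos).le (min_le_right _ _)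
  have hlt : ENNReal.ofReal (1 - δ / 8) < 1 := by
    rw [← ENNReal.ofReal_one, ENNReal.ofReal_lt_ofReal_iff one_pos]
    linarith
  obtain ⟨N, hN, hgt, hN2⟩ := (hfreq.and_eventually
    (((hrec (δ / 8) (by positivity)).eventually (lt_mem_nhds hlt)).and
      (eventually_ge_atTop 2))).exists
  have hσN := hσ N (by omega)
  obtain ⟨M, hMfin, hM, hmass⟩ := hoverlap (σ N) hσN
  rw [abs_of_pos hσN] at hN
  have hδσ : δ ≤ c * min (σ N) 1 :=
    mul_le_mul_of_nonneg_left (min_le_min hN.le le_rfl) hc.le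
  have hle := almost_exact_success_le hN2 L (σ N) (e N) M hM hδ0.le hδ1
    (hmass.trans (ENNReal.ofReal_le_ofReal (by linarith)))
  refine absurd hgt (not_lt.2 ?_)
  rw [← ofReal_measureReal]
  exact ENNReal.ofReal_le_ofReal hle

end LineMixture

theorem theorem1 (L : LineMixture.Label → LineMixture.PlaneSegment)
    (hlength : (L 0).length = (L 1).length)
    (hmid : (L 0).mid = (L 1).mid)
    (hcross : (L 0).carrier ∩ (L 1).carrier = {(L 0).mid})
    (σ : ℕ → ℝ) (hσ : ∀ N, 1 ≤ N → 0 < σ N) :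
    -- exact recovery is possible iff `σ_N ≪ 1 / N`
    ((∃ e : ∀ N, LineMixture.Estimator N, LineMixture.ExactRecovery L σ e) ↔
      σ =o[atTop] (fun N : ℕ => 1 / (N : ℝ))) ∧
    -- almost exact recovery is possible iff `σ_N ≪ 1`
    ((∃ e : ∀ N, LineMixture.Estimator N, LineMixture.AlmostExactRecovery L σ e) ↔
      σ =o[atTop] (fun _ : ℕ => (1 : ℝ))) ∧
    -- the maximum likelihood estimator achieves both
    (σ =o[atTop] (fun N : ℕ => 1 / (N : ℝ)) →
      LineMixture.ExactRecovery L σ (fun N => LineMixture.mle N L (σ N))) ∧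
    (σ =o[atTop] (fun _ : ℕ => (1 : ℝ)) →
      LineMixture.AlmostExactRecovery L σ (fun N => LineMixture.mle N L (σ N))) ∧
    -- no (possibly randomized) estimator succeeds outside these conditions
    (¬ σ =o[atTop] (fun N : ℕ => 1 / (N : ℝ)) →
      ∀ e : ∀ N, LineMixture.Estimator N, ¬ LineMixture.ExactRecovery L σ e) ∧
    (¬ σ =o[atTop] (fun _ : ℕ => (1 : ℝ)) →
      ∀ e : ∀ N, LineMixture.Estimator N, ¬ LineMixture.AlmostExactRecovery L σ e) := by

  have h1 := LineMixture.mle_exactRecovery L hlength hmid σ hσ hcross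
  have h2 := LineMixture.mle_almostExactRecovery L hlength hmid σ hσ hcross
  have h3 := LineMixture.not_exactRecovery L hlength hmid σ hσ
  have h4 := LineMixture.not_almostExactRecovery L hlength hmid σ hσ
  refine ⟨⟨?_, fun h => ⟨_, h1 h⟩⟩, ⟨?_, fun h => ⟨_, h2 h⟩⟩, h1, h2, h3, h4⟩
  · rintro ⟨e, he⟩
    by_contra h
    exact h3 h e he
  · rintro ⟨e, he⟩
    by_contra h
    exact h4 h e he
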